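/- Let $(W,S_0)$ be a finite Coxeter system (possibly non-crystallographic), acting faithfully on a finite-dimensional real vector space $V$ so that every simple reflection $s\in S_0$ acts as a linear reflection (for instance the geometric representation). Let $J$ be the ideal of the polynomial ring $\mathbb{R}[V]$ generated by the $W$-invariant polynomials without constant term, and let $R=\mathbb{R}[V]/J=\bigoplus_d R_d$ be the coinvariant ring, with the induced grading and $W$-action. For a subset $S\subseteq S_0$ let $W_S=\langle S\rangle$ be the corresponding parabolic subgroup, and let $R^{W_S}=\{f\in R : wf=f \text{ for all } w\in W_S\}$ be the parabolic invariant, graded by $R^{W_S}_d=R^{W_S}\cap R_d$. Call $\ell\in R^{W_S}_1$ a strong Lefschetz element of $R^{W_S}$ if there is an integer $m\ge 0$ with $R^{W_S}_d=0$ for all $d>m$, $\dim_{\mathbb R} R^{W_S}_d=\dim_{\mathbb R} R^{W_S}_{m-d}$ for $0\le d\le m$, and such that the multiplication map $$\times\,\ell^{\,m-2i}\colon R^{W_S}_i\to R^{W_S}_{m-i}$$ is bijective for every $i=0,1,\dots,\lfloor m/2\rfloor$. (Such an $m$ is necessarily the largest degree in which $R^{W_S}$ is nonzero.) If $\ell\in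 R^{W_S}_1$ is a strong Lefschetz element of $R^{W_S}$, then $\ell$ is not fixed by any reflection of $W$ (that is, any $W$-conjugate of an element of $S_0$) that lies in $W\smallsetminus W_S$. -/

import Mathlib

noncomputable section

namespace Coinvariant

/-- A linear endomorphism of a real vector space is a reflection if it has the form
`y ↦ y - f y • x` with `f x = 2`: it negates the nonzero vector `x` and fixes the
hyperplane `ker f` pointwise. -/
def IsLinearReflection {V : Type*} [AddCommGroup V] [Module ℝ V] (g : V →ₗ[ℝ] V) : Prop :=
  ∃ (x : V) (f : Module.Dual ℝ V), f x = 2 ∧ g = Module.preReflection x f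

/-- The polynomial ring `ℝ[V]`: the symmetric algebra of the dual space of `V`. -/
abbrev Poly (V : Type*) [AddCommGroup V] [Module ℝ V] : Type _ :=
  SymmetricAlgebra ℝ (Module.Dual ℝ V)

/-- The space of homogeneous polynomials of degree `d`: the linear span of the products of
`d` linear forms. -/
def polyComponent (V : Type*) [AddCommGroup V] [Module ℝ V] (d : ℕ) : Submodule ℝ (Poly V) :=
  LinearMap.range (SymmetricAlgebra.ι ℝ (Module.Dual ℝ V)) ^ d

section Representation

variable {W V : Type*} [Group W] [AddCommGroup V] [Module ℝ V] (ρ : Representation ℝ W V)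

/-- The action of `w` on `ℝ[V]`, `(w p)(v) = p (w⁻¹ v)`: the algebra endomorphism that extends
the contragredient action on linear forms. -/
def polyAct (w : W) : Poly V →ₐ[ℝ] Poly V :=
  SymmetricAlgebra.lift (SymmetricAlgebra.ι ℝ (Module.Dual ℝ V) ∘ₗ ρ.dual w)

/-- The ideal `J` of `ℝ[V]` generated by the `W`-invariant polynomials without constant term. -/
def coinvariantIdeal : Ideal (Poly V) :=
  Ideal.span {p | (∀ w : W, polyAct ρ w p = p) ∧ SymmetricAlgebra.algebraMapInv p = 0}

theorem coinvariantIdeal_le_comap (w : W) :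
    coinvariantIdeal ρ ≤ (coinvariantIdeal ρ).comap (polyAct ρ w) := by
  refine Ideal.span_le.2 fun p hp => ?_
  change polyAct ρ w p ∈ coinvariantIdeal ρ
  rw [hp.1 w]
  exact Ideal.subset_span hp

/-- The coinvariant ring `R = ℝ[V] / J`. -/
abbrev CoinvariantRing : Type _ := Poly V ⧸ coinvariantIdeal ρ

/-- The action of `w` on the coinvariant ring. -/
def act (w : W) : CoinvariantRing ρ →ₐ[ℝ] CoinvariantRing ρ :=
  Ideal.quotientMapₐ (coinvariantIdeal ρ) (polyAct ρ w) (coinvariantIdeal_le_comap ρ w)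

/-- The homogeneous component `R_d` of the coinvariant ring: the image of the homogeneous
polynomials of degree `d`. -/
def component (d : ℕ) : Submodule ℝ (CoinvariantRing ρ) :=
  (polyComponent V d).map (Ideal.Quotient.mkₐ ℝ (coinvariantIdeal ρ)).toLinearMap

/-- The subalgebra `R^H` of the elements of the coinvariant ring `R` of `W` that are fixed by the
subgroup `H` of `W`. -/
def invariants (H : Subgroup W) : Subalgebra ℝ (CoinvariantRing ρ) where
  carrier := {f | ∀ w ∈ H, act ρ w f = f}
  mul_mem' ha hb w hw := by rw [map_mul, ha w hw, hb w hw]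
  add_mem' ha hb w hw := by rw [map_add, ha w hw, hb w hw]
  algebraMap_mem' r w _ := (act ρ w).commutes r

/-- The homogeneous component `R^H_d = R^H ∩ R_d`. -/
def invariantsComponent (H : Subgroup W) (d : ℕ) : Submodule ℝ (invariants ρ H) :=
  (component ρ d).comap (invariants ρ H).val.toLinearMap

end Representation

/-- Strong Lefschetz elements of a commutative graded real algebra `A = ⨁_{d = 0}^m A_d` with
symmetric Hilbert function, given by the family `𝒜` of its homogeneous components: `ℓ` has
degree one, and multiplication by `ℓ ^ (m - 2 i)` is a bijection from `A_i` onto `A_{m - i}` for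
`i = 0, …, ⌊m / 2⌋`. If `A` is not zero, then symmetry forces `A_m` to be nonzero, so that `m` is
the largest degree in which `A` does not vanish. -/
def IsStrongLefschetzElement {A : Type*} [CommRing A] [Algebra ℝ A] (𝒜 : ℕ → Submodule ℝ A)
    (ℓ : A) : Prop :=
  ℓ ∈ 𝒜 1 ∧ ∃ m : ℕ,
    (∀ d, m < d → 𝒜 d = ⊥) ∧
    (∀ d, d ≤ m → Module.finrank ℝ (𝒜 d) = Module.finrank ℝ (𝒜 (m - d))) ∧
    ∀ i, i ≤ m / 2 → Set.BijOn (fun f => ℓ ^ (m - 2 * i) * f) (𝒜 i) (𝒜 (m - i))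

/-- The parabolic subgroup `W_S` generated by a set `S` of simple reflections. -/
def parabolicSubgroup {B W : Type*} [Group W] {M : CoxeterMatrix B} (cs : CoxeterSystem M W)
    (S : Set B) : Subgroup W :=
  Subgroup.closure (cs.simple '' S)

end Coinvariant

end

noncomputable section

namespace Coinvariant

open SymmetricAlgebra

/-! ### Linear forms as prime elements of the polynomial ring. -/

section Preliminaries

variable {V : Type*} [AddCommGroup V] [Module ℝ V]

/-! For a subgroup `H`, let `N_H` be the number of reflections in `H` and `Δ_H` the product of their
linear forms; write `N`, `Δ` for `H = W`. Two degree estimates collide. The product of the forms of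
the reflections outside `W_S` is a nonzero `W_S`-invariant of degree `N - N_{W_S}`
(`exists_ne_zero_mem_component`), so `m ≥ N - N_{W_S}`. Conversely, `R^H` vanishes in degrees above
`N - N_H` for every subgroup `H` (`eq_zero_of_mem_component`). If a reflection outside `W_S` fixes
`ℓ`, the stabilizer `H` of `ℓ` has `N_H > N_{W_S}`, so `ℓ ^ m = 0`; but the Lefschetz property at `i
= 0` gives `ℓ ^ m ≠ 0`.

The vanishing rests on the socle of `R` being the line spanned by `Δ`: a nonzero `f ∈ R^H` of degree
`d` has a multiple `f g = c Δ` with `c ≠ 0`. Antisymmetrizing over `H` replaces `g` by a multiple of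
`Δ_H` and `c` by `|H| c`, which forces `d + N_H ≤ N`. -/

theorem exists_smul_eq_of_preReflection_eq {x x' : V} {f f' : Module.Dual ℝ V} (hx : f x = 2)
    (h : Module.preReflection x f = Module.preReflection x' f') : ∃ c : ℝ, f = c • f' := by
  refine ⟨f x' / 2, LinearMap.ext fun y => ?_⟩
  have h1 := congrArg f (LinearMap.congr_fun h y)
  simp only [Module.preReflection_apply, map_sub, map_smul, smul_eq_mul, hx] at h1
  simp only [LinearMap.smul_apply, smul_eq_mul]
  linarith

theorem prime_ι {φ : Module.Dual ℝ V} (hφ : φ ≠ 0) : Prime (ι ℝ (Module.Dual ℝ V) φ) := by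
  have hli : LinearIndepOn ℝ id ({φ} : Set (Module.Dual ℝ V)) :=
    LinearIndepOn.singleton (by simpa using hφ)
  let b := Module.Basis.extend hli
  let i : hli.extend (Set.subset_univ _) := ⟨φ, hli.subset_extend _ rfl⟩
  have hb : b i = φ := Module.Basis.extend_apply_self hli i
  have h := (MulEquiv.prime_iff (equivMvPolynomial b).symm.toMulEquiv).2
    (MvPolynomial.X_prime (R := ℝ) (i := i))
  simpa [hb] using h

theorem exists_smul_eq_of_ι_dvd {φ ψ : Module.Dual ℝ V}
    (h : ι ℝ (Module.Dual ℝ V) φ ∣ ι ℝ (Module.Dual ℝ V) ψ) : ∃ c : ℝ, ψ = c • φ := by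
  obtain ⟨q, hq⟩ := h
  have hker : (⨅ _ : Unit, LinearMap.ker φ) ≤ LinearMap.ker ψ := by
    intro v hv
    have hv' : φ v = 0 := by simpa using hv
    have := congrArg (lift (Module.Dual.eval ℝ V v)) hq
    simpa [hv'] using this
  have hm := mem_span_of_iInf_ker_le_ker (L := fun _ : Unit => φ) hker
  rw [Set.range_const, Submodule.mem_span_singleton] at hm
  obtain ⟨c, hc⟩ := hm
  exact ⟨c, hc.symm⟩

end Preliminaries

/-! ### The group action, and nilpotency of positive degree modulo `J`. -/

section Action

variable {W V : Type*} [Group W] [AddCommGroup V] [Module ℝ V] (ρ : Representation ℝ W V)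

@[simp]
theorem polyAct_ι (w : W) (φ : Module.Dual ℝ V) :
    polyAct ρ w (ι ℝ _ φ) = ι ℝ _ (ρ.dual w φ) := by
  simp [polyAct]

theorem polyAct_mul_apply (w w' : W) (p : Poly V) :
    polyAct ρ (w * w') p = polyAct ρ w (polyAct ρ w' p) := by
  have : polyAct ρ (w * w') = (polyAct ρ w).comp (polyAct ρ w') := by
    ext φ
    simp
    rfl
  rw [this, AlgHom.comp_apply]

theorem polyAct_one_apply (p : Poly V) : polyAct ρ 1 p = p := by
  have : polyAct ρ 1 = AlgHom.id ℝ (Poly V) := by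
    ext φ
    simp
    rfl
  rw [this, AlgHom.id_apply]

theorem algebraMapInv_polyAct (w : W) (p : Poly V) :
    algebraMapInv (polyAct ρ w p) = algebraMapInv p := by
  have : algebraMapInv.comp (polyAct ρ w) = (algebraMapInv : Poly V →ₐ[ℝ] ℝ) := by
    ext φ
    simp [algebraMapInv_ι]
  rw [← AlgHom.comp_apply, this]

theorem polyAct_mem_coinvariantIdeal (w : W) {p : Poly V} (hp : p ∈ coinvariantIdeal ρ) :
    polyAct ρ w p ∈ coinvariantIdeal ρ :=
  coinvariantIdeal_le_comap ρ w hp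

theorem algebraMapInv_eq_zero_of_mem {p : Poly V} (hp : p ∈ coinvariantIdeal ρ) :
    algebraMapInv p = 0 := by
  have : coinvariantIdeal ρ ≤ RingHom.ker (algebraMapInv : Poly V →ₐ[ℝ] ℝ) :=
    Ideal.span_le.2 fun q hq => hq.2
  exact this hp

theorem one_notMem_coinvariantIdeal : (1 : Poly V) ∉ coinvariantIdeal ρ := fun h => by
  simpa using algebraMapInv_eq_zero_of_mem ρ h

theorem sub_algebraMap_mem_coinvariantIdeal {p : Poly V} (hp : ∀ w, polyAct ρ w p = p) :
    p - algebraMap ℝ _ (algebraMapInv p) ∈ coinvariantIdeal ρ := by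
  refine Ideal.subset_span ⟨fun w => ?_, ?_⟩
  · rw [map_sub, hp, AlgHom.commutes]
  · rw [map_sub, AlgHom.commutes, Algebra.algebraMap_self, RingHom.id_apply, sub_self]

theorem act_mk (w : W) (p : Poly V) :
    act ρ w (Ideal.Quotient.mk _ p) = Ideal.Quotient.mk _ (polyAct ρ w p) := rfl

theorem act_mul_apply (w w' : W) (f : CoinvariantRing ρ) :
    act ρ (w * w') f = act ρ w (act ρ w' f) := by
  obtain ⟨p, rfl⟩ := Ideal.Quotient.mk_surjective f
  simp only [act_mk, polyAct_mul_apply]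

theorem act_one_apply (f : CoinvariantRing ρ) : act ρ 1 f = f := by
  obtain ⟨p, rfl⟩ := Ideal.Quotient.mk_surjective f
  simp only [act_mk, polyAct_one_apply]

/-- The stabilizer of an element of the coinvariant ring. -/
def stabilizer (f : CoinvariantRing ρ) : Subgroup W where
  carrier := {w | act ρ w f = f}
  mul_mem' {a b} ha hb := by
    change act ρ (a * b) f = f
    rw [act_mul_apply, show act ρ b f = f from hb, show act ρ a f = f from ha]
  one_mem' := act_one_apply ρ f
  inv_mem' {a} ha := by
    change act ρ a⁻¹ f = f
    conv_lhs => rw [← show act ρ a f = f from ha]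
    rw [← act_mul_apply, inv_mul_cancel, act_one_apply]

theorem mem_stabilizer {f : CoinvariantRing ρ} {w : W} :
    w ∈ stabilizer ρ f ↔ act ρ w f = f := Iff.rfl

/-- The ideal of polynomials without constant term. -/
def augmentationIdeal (V : Type*) [AddCommGroup V] [Module ℝ V] : Ideal (Poly V) :=
  Ideal.span (Set.range (ι ℝ (Module.Dual ℝ V)))

theorem ι_mem_augmentationIdeal (φ : Module.Dual ℝ V) :
    ι ℝ _ φ ∈ augmentationIdeal V :=
  Ideal.subset_span ⟨φ, rfl⟩

theorem augmentationIdeal_fg [FiniteDimensional ℝ V] : (augmentationIdeal V).FG := by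
  let b := Module.finBasis ℝ (Module.Dual ℝ V)
  have h : augmentationIdeal V = Ideal.span (Set.range fun i => ι ℝ (Module.Dual ℝ V) (b i)) := by
    refine le_antisymm (Ideal.span_le.2 ?_) (Ideal.span_mono ?_)
    · rintro _ ⟨φ, rfl⟩
      rw [← b.sum_repr φ, map_sum]
      refine Ideal.sum_mem _ fun i _ => ?_
      rw [map_smul, Algebra.smul_def]
      exact Ideal.mul_mem_left _ _ (Ideal.subset_span ⟨i, rfl⟩)
    · rintro _ ⟨i, rfl⟩
      exact ⟨b i, rfl⟩
  rw [h]
  exact Submodule.fg_span (Set.finite_range _)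

/-- The orbit polynomial `∏ (X - wφ)` has invariant coefficients, all but the leading one without
constant term. Modulo `J` it is therefore `X ^ |W|`, and it has the root `φ`. -/
theorem ι_mem_radical [Finite W] (φ : Module.Dual ℝ V) :
    ι ℝ _ φ ∈ (coinvariantIdeal ρ).radical := by
  classical
  have := Fintype.ofFinite W
  let Q : Polynomial (Poly V) :=
    ∏ w : W, (Polynomial.X - Polynomial.C (polyAct ρ w (ι ℝ _ φ)))
  have hQ (u : W) : Q.map (polyAct ρ u : Poly V →+* Poly V) = Q := by
    simp only [Q, Polynomial.map_prod, Polynomial.map_sub, Polynomial.map_X, Polynomial.map_C,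
      RingHom.coe_coe, ← polyAct_mul_apply]
    exact Fintype.prod_equiv (Equiv.mulLeft u) _ _ fun w => rfl
  have hQ0 : Q.map ((algebraMapInv : Poly V →ₐ[ℝ] ℝ) : Poly V →+* ℝ) =
      Polynomial.X ^ Fintype.card W := by
    simp only [Q, Polynomial.map_prod, Polynomial.map_sub, Polynomial.map_X, Polynomial.map_C,
      RingHom.coe_coe, algebraMapInv_polyAct, algebraMapInv_ι, map_zero, sub_zero,
      Finset.prod_const, Finset.card_univ]
  have hQ1 : Q.map (Ideal.Quotient.mk (coinvariantIdeal ρ)) = Polynomial.X ^ Fintype.card W := by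
    ext i
    have hi : ∀ w, polyAct ρ w (Q.coeff i) = Q.coeff i := fun w => by
      conv_rhs => rw [← hQ w]
      rw [Polynomial.coeff_map, RingHom.coe_coe]
    have h0 := congrArg (fun q => Polynomial.coeff q i) hQ0
    simp only [Polynomial.coeff_map, RingHom.coe_coe] at h0
    rw [Polynomial.coeff_map, Ideal.Quotient.eq.2 (sub_algebraMap_mem_coinvariantIdeal ρ hi), h0,
      Polynomial.coeff_X_pow, Polynomial.coeff_X_pow]
    split_ifs <;> simp
  have hev : Q.eval (ι ℝ _ φ) = 0 := by
    rw [Polynomial.eval_prod]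
    refine Finset.prod_eq_zero (Finset.mem_univ 1) ?_
    rw [polyAct_one_apply, Polynomial.eval_sub, Polynomial.eval_X, Polynomial.eval_C, sub_self]
  refine ⟨Fintype.card W, Ideal.Quotient.eq_zero_iff_mem.1 ?_⟩
  have := congrArg (Polynomial.eval (Ideal.Quotient.mk (coinvariantIdeal ρ) (ι ℝ _ φ))) hQ1
  rw [Polynomial.eval_map_apply, hev, map_zero, Polynomial.eval_pow, Polynomial.eval_X] at this
  rw [map_pow, ← this]

theorem exists_augmentationIdeal_pow_le [Finite W] [FiniteDimensional ℝ V] :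
    ∃ n, augmentationIdeal V ^ n ≤ coinvariantIdeal ρ := by
  refine Ideal.exists_pow_le_of_le_radical_of_fg (Ideal.span_le.2 ?_) augmentationIdeal_fg
  rintro _ ⟨φ, rfl⟩
  exact ι_mem_radical ρ φ

end Action

/-! ### Homogeneity of `J`. -/

section Grading

variable {W V : Type*} [Group W] [AddCommGroup V] [Module ℝ V] (ρ : Representation ℝ W V)

/-- The grading of `ℝ[V]`, encoded by the algebra homomorphism `ℝ[V] → ℝ[V][X]` which sends a
homogeneous polynomial `p` of degree `d` to `p X ^ d`. -/
def homogenize (V : Type*) [AddCommGroup V] [Module ℝ V] : Poly V →ₐ[ℝ] Polynomial (Poly V) :=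
  lift (LinearMap.mulLeft ℝ Polynomial.X ∘ₗ Polynomial.CAlgHom.toLinearMap ∘ₗ
    ι ℝ (Module.Dual ℝ V))

@[simp]
theorem homogenize_ι (φ : Module.Dual ℝ V) :
    homogenize V (ι ℝ _ φ) = Polynomial.X * Polynomial.C (ι ℝ _ φ) := by
  simp [homogenize]

theorem polyAct_coeff_homogenize (w : W) (p : Poly V) (d : ℕ) :
    polyAct ρ w ((homogenize V p).coeff d) = (homogenize V (polyAct ρ w p)).coeff d := by
  have : (Polynomial.mapAlgHom (polyAct ρ w)).comp (homogenize V) =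
      (homogenize V).comp (polyAct ρ w) := by
    ext φ : 2
    simp
  have h := congrArg (fun q => Polynomial.coeff q d) (DFunLike.congr_fun this p)
  simpa using h

theorem algebraMapInv_coeff_homogenize {p : Poly V} (hp : algebraMapInv p = (0 : ℝ)) (d : ℕ) :
    algebraMapInv ((homogenize V p).coeff d) = (0 : ℝ) := by
  have : (Polynomial.mapAlgHom (algebraMapInv : Poly V →ₐ[ℝ] ℝ)).comp (homogenize V) =
      Polynomial.CAlgHom.comp algebraMapInv := by
    ext φ : 2
    simp [algebraMapInv_ι]
  have h := congrArg (fun q => Polynomial.coeff q d) (DFunLike.congr_fun this p)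
  simpa [hp] using h

/-- The homogeneous parts of each generator of `J` are again invariant without constant term. -/
theorem coeff_homogenize_mem_coinvariantIdeal {p : Poly V} (hp : p ∈ coinvariantIdeal ρ) (d : ℕ) :
    (homogenize V p).coeff d ∈ coinvariantIdeal ρ := by
  have : coinvariantIdeal ρ ≤
      ((coinvariantIdeal ρ).map Polynomial.C).comap (homogenize V) := by
    refine Ideal.span_le.2 fun q hq => ?_
    refine Ideal.mem_map_C_iff.2 fun d => Ideal.subset_span ⟨fun w => ?_, ?_⟩
    · rw [polyAct_coeff_homogenize, hq.1]
    · exact algebraMapInv_coeff_homogenize hq.2 d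
  exact Ideal.mem_map_C_iff.1 (this hp) d

theorem coeff_homogenize_eq_zero {n d : ℕ} (hd : d < n) {p : Poly V}
    (hp : p ∈ augmentationIdeal V ^ n) : (homogenize V p).coeff d = 0 := by
  have h1 : augmentationIdeal V ≤ (Ideal.span {Polynomial.X}).comap (homogenize V) := by
    refine Ideal.span_le.2 ?_
    rintro _ ⟨φ, rfl⟩
    refine Ideal.mem_span_singleton.2 ?_
    rw [homogenize_ι]
    exact dvd_mul_right _ _
  have h2 := (Ideal.pow_right_mono h1 n).trans (Ideal.le_comap_pow _ n) hp
  rw [Ideal.mem_comap, Ideal.span_singleton_pow, Ideal.mem_span_singleton,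
    Polynomial.X_pow_dvd_iff] at h2
  exact h2 d hd

theorem mem_augmentationIdeal_pow {d : ℕ} {p : Poly V} (hp : p ∈ polyComponent V d) :
    p ∈ augmentationIdeal V ^ d := by
  have h : LinearMap.range (ι ℝ (Module.Dual ℝ V)) ≤
      (augmentationIdeal V).restrictScalars ℝ := by
    rintro _ ⟨φ, rfl⟩
    exact ι_mem_augmentationIdeal φ
  induction d generalizing p with
  | zero => simp
  | succ d ih =>
    rw [polyComponent, pow_succ] at hp
    rw [pow_succ]
    induction hp using Submodule.mul_induction_on' with
    | mem_mul_mem a ha b hb => exact Ideal.mul_mem_mul (ih ha) (h hb)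
    | add a _ b _ ha hb => exact add_mem ha hb

end Grading

/-- A conjugation-invariant set of linear reflections that generates the group, with a choice of
a root and a linear form for each of them, and the sign character. -/
structure ReflectionSystem {W V : Type*} [Group W] [AddCommGroup V] [Module ℝ V]
    (ρ : Representation ℝ W V) where
  /-- the reflections -/
  refl : Set W
  /-- the vectors that are negated -/
  root : W → V
  /-- the linear forms that define the reflecting hyperplanes -/
  form : W → Module.Dual ℝ V
  /-- the sign character -/
  sign : W →* ℝ
  conj_mem : ∀ w, ∀ t ∈ refl, w * t * w⁻¹ ∈ refl
  closure_eq : Subgroup.closure refl = ⊤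
  form_root : ∀ t ∈ refl, form t (root t) = 2
  apply_eq : ∀ t ∈ refl, ρ t = Module.preReflection (root t) (form t)
  sign_eq : ∀ t ∈ refl, sign t = -1

/-! ### Reflections, their linear forms, and anti-invariant polynomials. -/

namespace ReflectionSystem

variable {W V : Type*} [Group W] [AddCommGroup V] [Module ℝ V] {ρ : Representation ℝ W V}
  (D : ReflectionSystem ρ)

/-- The product of the linear forms of a finite set of reflections. -/
def formProd (A : Finset W) : Poly V := ∏ t ∈ A, ι ℝ _ (D.form t)

variable {D}

theorem form_ne_zero {t : W} (ht : t ∈ D.refl) : D.form t ≠ 0 := fun h => by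
  simpa [h] using D.form_root t ht

theorem prime_form {t : W} (ht : t ∈ D.refl) : Prime (ι ℝ _ (D.form t)) :=
  prime_ι (form_ne_zero ht)

theorem ρ_mul_self {t : W} (ht : t ∈ D.refl) : ρ t * ρ t = 1 := by
  ext y
  rw [D.apply_eq t ht]
  exact Module.involutive_preReflection (D.form_root t ht) y

theorem ρ_inv {t : W} (ht : t ∈ D.refl) : ρ t⁻¹ = ρ t := by
  have h := congrArg (fun g => ρ t⁻¹ * g) (ρ_mul_self ht)
  simpa [← mul_assoc, ← map_mul] using h.symm

theorem polyAct_ι_of_mem {t : W} (ht : t ∈ D.refl) (φ : Module.Dual ℝ V) :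
    polyAct ρ t (ι ℝ _ φ) = ι ℝ _ φ - φ (D.root t) • ι ℝ _ (D.form t) := by
  rw [polyAct_ι, ← map_smul, ← map_sub]
  congr 1
  ext y
  rw [Representation.dual_apply, Module.Dual.transpose_apply, LinearMap.comp_apply, ρ_inv ht,
    D.apply_eq t ht]
  simp [Module.preReflection_apply, mul_comm]

theorem polyAct_form {t : W} (ht : t ∈ D.refl) :
    polyAct ρ t (ι ℝ _ (D.form t)) = -ι ℝ _ (D.form t) := by
  rw [polyAct_ι_of_mem ht, D.form_root t ht, two_smul]
  abel

theorem polyAct_polyAct {t : W} (ht : t ∈ D.refl) (p : Poly V) :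
    polyAct ρ t (polyAct ρ t p) = p := by
  have : (polyAct ρ t).comp (polyAct ρ t) = AlgHom.id ℝ (Poly V) := by
    ext φ
    change polyAct ρ t (polyAct ρ t (ι ℝ _ φ)) = ι ℝ _ φ
    simp only [polyAct_ι_of_mem ht, map_sub, map_smul, D.form_root t ht]
    module
  exact DFunLike.congr_fun this p

/-- Modulo its own form, `t` fixes every linear form, hence every polynomial. The quotient is the
divided difference of `p`. -/
theorem form_dvd_sub_polyAct {t : W} (ht : t ∈ D.refl) (p : Poly V) :
    ι ℝ _ (D.form t) ∣ p - polyAct ρ t p := by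
  have : (Ideal.Quotient.mkₐ ℝ (Ideal.span {ι ℝ _ (D.form t)})).comp (polyAct ρ t) =
      Ideal.Quotient.mkₐ ℝ (Ideal.span {ι ℝ _ (D.form t)}) := by
    ext φ
    change Ideal.Quotient.mk _ (polyAct ρ t (ι ℝ _ φ)) = Ideal.Quotient.mk _ (ι ℝ _ φ)
    rw [polyAct_ι_of_mem ht, Ideal.Quotient.eq, sub_sub_cancel_left, neg_mem_iff,
      Ideal.mem_span_singleton, Algebra.smul_def]
    exact dvd_mul_left _ _
  have h := DFunLike.congr_fun this p
  exact Ideal.mem_span_singleton.1 (Ideal.Quotient.eq.1 h.symm)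

theorem form_dvd_of_polyAct_eq_neg {t : W} (ht : t ∈ D.refl) {p : Poly V}
    (hp : polyAct ρ t p = -p) : ι ℝ _ (D.form t) ∣ p := by
  have h := form_dvd_sub_polyAct ht p
  rw [hp, sub_neg_eq_add, ← two_smul ℝ] at h
  have h2 := h.trans (Dvd.intro_left (algebraMap ℝ (Poly V) (1 / 2)) rfl)
  rwa [← Algebra.smul_def, smul_smul, one_div, inv_mul_cancel₀ two_ne_zero, one_smul] at h2

/-- Forms are chosen separately for each reflection, so conjugation respects them only up to a
scalar. -/
theorem exists_polyAct_form_eq (w : W) {t : W} (ht : t ∈ D.refl) :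
    ∃ c : ℝ, polyAct ρ w (ι ℝ _ (D.form t)) = c • ι ℝ _ (D.form (w * t * w⁻¹)) := by
  have hinv (y : V) : ρ w⁻¹ (ρ w y) = y := by
    rw [← Module.End.mul_apply, ← map_mul, inv_mul_cancel, map_one, Module.End.one_apply]
  have hinv' (y : V) : ρ w (ρ w⁻¹ y) = y := by
    rw [← Module.End.mul_apply, ← map_mul, mul_inv_cancel, map_one, Module.End.one_apply]
  obtain ⟨c, hc⟩ := exists_smul_eq_of_preReflection_eq
    (x := ρ w (D.root t)) (x' := D.root (w * t * w⁻¹)) (f := ρ.dual w (D.form t))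
    (f' := D.form (w * t * w⁻¹))
    (by
      rw [Representation.dual_apply, Module.Dual.transpose_apply, LinearMap.comp_apply, hinv,
        D.form_root t ht])
    (by
      rw [← D.apply_eq _ (D.conj_mem w t ht), map_mul, map_mul, D.apply_eq t ht]
      ext y
      simp only [Module.End.mul_apply, Module.preReflection_apply, map_sub, map_smul, hinv',
        Representation.dual_apply, Module.Dual.transpose_apply, LinearMap.comp_apply])
  exact ⟨c, by rw [polyAct_ι, hc, map_smul]⟩

theorem formProd_ne_zero {A : Finset W} (hA : ↑A ⊆ D.refl) : D.formProd A ≠ 0 :=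
  Finset.prod_ne_zero_iff.2 fun _ ht => (prime_form (hA ht)).ne_zero

theorem sign_mul_self (w : W) : D.sign w * D.sign w = 1 := by
  have hw : w ∈ Subgroup.closure D.refl := D.closure_eq ▸ Subgroup.mem_top w
  induction hw using Subgroup.closure_induction with
  | mem t ht => rw [D.sign_eq t ht]; norm_num
  | one => simp
  | mul x y _ _ hx hy => rw [map_mul, mul_mul_mul_comm, hx, hy, one_mul]
  | inv x _ hx =>
    have h : D.sign x⁻¹ * D.sign x = 1 := by rw [← map_mul, inv_mul_cancel, map_one]
    rw [← mul_one (_ * _), ← hx, mul_mul_mul_comm, h, one_mul, hx]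

section Injective

variable [Finite W]

/-- If two reflections share a hyperplane, their product is a transvection `y ↦ y + f y • d` with `f
d = 0`. Finite order forces `d = 0`, and faithfulness gives equality. -/
theorem eq_of_form_dvd (hρ : Function.Injective ρ) {t t' : W} (ht : t ∈ D.refl) (ht' : t' ∈ D.refl)
    (h : ι ℝ _ (D.form t) ∣ ι ℝ _ (D.form t')) : t = t' := by
  obtain ⟨c, hc⟩ := exists_smul_eq_of_ι_dvd h
  have hc2 : c * D.form t (D.root t') = 2 := by
    rw [← D.form_root t' ht', hc, LinearMap.smul_apply, smul_eq_mul]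
  set d := D.root t - c • D.root t' with hd
  have hfd : D.form t d = 0 := by
    rw [hd, map_sub, map_smul, smul_eq_mul, hc2, D.form_root t ht, sub_self]
  have hact (y : V) : ρ (t * t') y = y + D.form t y • d := by
    rw [map_mul, Module.End.mul_apply, D.apply_eq t ht, D.apply_eq t' ht', hc]
    simp only [Module.preReflection_apply, map_sub, map_smul, LinearMap.smul_apply, smul_eq_mul,
      hd]
    match_scalars <;> first | ring1 | linear_combination (D.form t y) * hc2
  have hpow (n : ℕ) (y : V) : ρ ((t * t') ^ n) y = y + (n * D.form t y) • d := by
    induction n with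
    | zero => simp
    | succ n ih =>
      rw [pow_succ', map_mul, Module.End.mul_apply, ih, map_add, map_smul, hact, hact, hfd]
      push_cast
      module
  have hd0 : d = 0 := by
    have h1 := hpow (orderOf (t * t')) (D.root t)
    rw [pow_orderOf_eq_one, map_one, Module.End.one_apply, left_eq_add, smul_eq_zero,
      D.form_root t ht] at h1
    have h2 : (orderOf (t * t') : ℝ) ≠ 0 := by exact_mod_cast (orderOf_pos _).ne'
    exact h1.resolve_left (mul_ne_zero h2 two_ne_zero)
  have h1 : ρ t * ρ t' = ρ t * ρ t := by
    rw [ρ_mul_self ht, ← map_mul]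
    ext y
    rw [hact, hd0, smul_zero, add_zero, Module.End.one_apply]
  rw [← map_mul, ← map_mul] at h1
  exact (mul_left_cancel (hρ h1)).symm

theorem not_form_dvd_formProd (hρ : Function.Injective ρ) {A : Finset W} (hA : ↑A ⊆ D.refl) {t : W}
    (ht : t ∈ D.refl) (htA : t ∉ A) : ¬ ι ℝ _ (D.form t) ∣ D.formProd A := fun h => by
  obtain ⟨u, hu, hdvd⟩ := (prime_form ht).exists_mem_finset_dvd h
  exact htA (eq_of_form_dvd hρ ht (hA hu) hdvd ▸ hu)

theorem formProd_dvd (hρ : Function.Injective ρ) {A : Finset W} (hA : ↑A ⊆ D.refl) {p : Poly V}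
    (hp : ∀ t ∈ A, ι ℝ _ (D.form t) ∣ p) : D.formProd A ∣ p := by
  classical
  induction A using Finset.induction_on with
  | empty => simp [formProd]
  | insert t A htA ih =>
    rw [Finset.coe_insert, Set.insert_subset_iff] at hA
    obtain ⟨q, rfl⟩ := ih hA.2 fun u hu => hp u (Finset.mem_insert_of_mem hu)
    have h := ((prime_form hA.1).dvd_or_dvd (hp t (Finset.mem_insert_self _ _))).resolve_left
      (not_form_dvd_formProd hρ hA.2 hA.1 htA)
    rw [formProd, Finset.prod_insert htA, mul_comm (ι ℝ _ (D.form t))]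
    exact mul_dvd_mul_left _ h

/-- The reflections in a subgroup. -/
def reflFinset (D : ReflectionSystem ρ) (H : Subgroup W) : Finset W :=
  (Set.toFinite (D.refl ∩ H)).toFinset

@[simp]
theorem mem_reflFinset {H : Subgroup W} {t : W} : t ∈ D.reflFinset H ↔ t ∈ D.refl ∧ t ∈ H := by
  simp [reflFinset]

theorem coe_reflFinset_subset (H : Subgroup W) : ↑(D.reflFinset H) ⊆ D.refl :=
  fun _ ht => (mem_reflFinset.1 ht).1

theorem polyAct_formProd (hρ : Function.Injective ρ) (H : Subgroup W) {s : W}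
    (hs : s ∈ D.reflFinset H) :
    polyAct ρ s (D.formProd (D.reflFinset H)) = -D.formProd (D.reflFinset H) := by
  classical
  have hsr := (mem_reflFinset.1 hs).1
  have hsH := (mem_reflFinset.1 hs).2
  have hne := formProd_ne_zero (coe_reflFinset_subset (D := D) H)
  choose! c hc using fun t (ht : t ∈ D.refl) => exists_polyAct_form_eq s ht
  obtain ⟨a, ha⟩ : ∃ a : ℝ, polyAct ρ s (D.formProd (D.reflFinset H)) =
      a • D.formProd (D.reflFinset H) := by
    refine ⟨∏ t ∈ D.reflFinset H, c t, ?_⟩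
    rw [formProd, map_prod, Finset.prod_congr rfl fun t ht => hc t (mem_reflFinset.1 ht).1,
      Finset.prod_smul]
    congr 1
    refine Finset.prod_nbij' (fun t => s * t * s⁻¹) (fun t => s⁻¹ * t * s) ?_ ?_ ?_ ?_ ?_
    · intro t ht
      rw [mem_reflFinset] at ht ⊢
      exact ⟨D.conj_mem s t ht.1, H.mul_mem (H.mul_mem hsH ht.2) (H.inv_mem hsH)⟩
    · intro t ht
      rw [mem_reflFinset] at ht ⊢
      refine ⟨?_, H.mul_mem (H.mul_mem (H.inv_mem hsH) ht.2) hsH⟩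
      simpa using D.conj_mem s⁻¹ t ht.1
    · intro t _
      group
    · intro t _
      group
    · intro t _
      rfl
  have ha2 : a * a = 1 := by
    have h := polyAct_polyAct hsr (D.formProd (D.reflFinset H))
    rw [ha, map_smul, ha, smul_smul] at h
    refine smul_left_injective ℝ hne ?_
    simpa using h
  rcases mul_self_eq_one_iff.1 ha2 with rfl | rfl
  -- If `a = 1`, the product of the other forms would be negated by `s`, hence divisible by the form
  -- of `s`.
  · exfalso
    have hA : ↑((D.reflFinset H).erase s) ⊆ D.refl :=
      (Finset.coe_subset.2 (Finset.erase_subset _ _)).trans (coe_reflFinset_subset H)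
    refine not_form_dvd_formProd hρ hA hsr (Finset.notMem_erase s _)
      (form_dvd_of_polyAct_eq_neg hsr ?_)
    rw [one_smul, formProd, ← Finset.mul_prod_erase _ _ hs, map_mul, polyAct_form hsr] at ha
    refine mul_left_cancel₀ (prime_form hsr).ne_zero ?_
    change _ * polyAct ρ s (∏ t ∈ (D.reflFinset H).erase s, _) =
      _ * -(∏ t ∈ (D.reflFinset H).erase s, _)
    linear_combination -ha
  · rw [ha, neg_one_smul]

theorem polyAct_formProd_top (hρ : Function.Injective ρ) (w : W) :
    polyAct ρ w (D.formProd (D.reflFinset ⊤)) = D.sign w • D.formProd (D.reflFinset ⊤) := by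
  have hw : w ∈ Subgroup.closure D.refl := D.closure_eq ▸ Subgroup.mem_top w
  induction hw using Subgroup.closure_induction_left with
  | one => rw [polyAct_one_apply, map_one, one_smul]
  | mul_left t ht y _ hy =>
    rw [polyAct_mul_apply, hy, map_smul, polyAct_formProd hρ ⊤ (by simpa using ht), map_mul,
      D.sign_eq t ht]
    module
  | inv_mul_cancel t ht y _ hy =>
    have : t⁻¹ = t := hρ (ρ_inv ht)
    rw [this, polyAct_mul_apply, hy, map_smul, polyAct_formProd hρ ⊤ (by simpa using ht), map_mul,
      D.sign_eq t ht]
    module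

/-- Every polynomial that is anti-invariant under the reflections in `H` is divisible by the
product of the linear forms of these reflections. -/
theorem formProd_dvd_of_antiinvariant (hρ : Function.Injective ρ) {H : Subgroup W} {p : Poly V}
    (hp : ∀ t ∈ D.reflFinset H, polyAct ρ t p = -p) : D.formProd (D.reflFinset H) ∣ p :=
  formProd_dvd hρ (coe_reflFinset_subset H) fun t ht =>
    form_dvd_of_polyAct_eq_neg (mem_reflFinset.1 ht).1 (hp t ht)

/-- Up to a scalar, the projection to the polynomials that are anti-invariant under `H`. -/
def antisymmetrize (D : ReflectionSystem ρ) (H : Subgroup W) (p : Poly V) : Poly V :=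
  letI := Fintype.ofFinite H
  ∑ w : H, D.sign w • polyAct ρ w p

theorem polyAct_antisymmetrize {H : Subgroup W} (p : Poly V) {t : W} (ht : t ∈ D.reflFinset H) :
    polyAct ρ t (D.antisymmetrize H p) = -D.antisymmetrize H p := by
  let _ := Fintype.ofFinite H
  rw [mem_reflFinset] at ht
  rw [antisymmetrize, map_sum, ← Finset.sum_neg_distrib]
  refine Fintype.sum_equiv (Equiv.mulLeft (⟨t, ht.2⟩ : H)) _ _ fun w => ?_
  rw [Equiv.coe_mulLeft, Subgroup.coe_mul, map_mul, D.sign_eq t ht.1, polyAct_mul_apply, map_smul]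
  module

theorem exists_antisymmetrize_eq_mul (hρ : Function.Injective ρ) (H : Subgroup W) (p : Poly V) :
    ∃ q, D.antisymmetrize H p = D.formProd (D.reflFinset H) * q :=
  formProd_dvd_of_antiinvariant hρ fun _ ht => polyAct_antisymmetrize p ht

end Injective

end ReflectionSystem

/-! ### The socle of the coinvariant ring and the top degree of invariants. -/

namespace ReflectionSystem

variable {W V : Type*} [Group W] [AddCommGroup V] [Module ℝ V] {ρ : Representation ℝ W V}
  {D : ReflectionSystem ρ}

/-- Divided differences preserve `J`: they kill its invariant generators and satisfy a twisted
Leibniz rule. -/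
theorem exists_sub_polyAct_eq {t : W} (ht : t ∈ D.refl) {p : Poly V}
    (hp : p ∈ coinvariantIdeal ρ) :
    ∃ k ∈ coinvariantIdeal ρ, p - polyAct ρ t p = ι ℝ _ (D.form t) * k := by
  induction hp using Submodule.span_induction with
  | mem q hq => exact ⟨0, zero_mem _, by rw [hq.1, sub_self, mul_zero]⟩
  | zero => exact ⟨0, zero_mem _, by simp⟩
  | add a b _ _ ha hb =>
    obtain ⟨k, hk, hak⟩ := ha
    obtain ⟨l, hl, hbl⟩ := hb
    exact ⟨k + l, add_mem hk hl, by rw [map_add, mul_add, ← hak, ← hbl]; ring⟩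
  | smul a b hb ih =>
    obtain ⟨k, hk, hbk⟩ := ih
    obtain ⟨l, hal⟩ := form_dvd_sub_polyAct ht a
    refine ⟨l * b + polyAct ρ t a * k,
      add_mem (Ideal.mul_mem_left _ _ hb) (Ideal.mul_mem_left _ _ hk), ?_⟩
    rw [smul_eq_mul, map_mul]
    linear_combination b * hal + polyAct ρ t a * hbk

theorem add_polyAct_mem {t : W} (ht : t ∈ D.refl) {p : Poly V}
    (hp : ι ℝ _ (D.form t) * p ∈ coinvariantIdeal ρ) :
    p + polyAct ρ t p ∈ coinvariantIdeal ρ := by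
  obtain ⟨k, hk, h⟩ := exists_sub_polyAct_eq ht hp
  rw [map_mul, polyAct_form ht] at h
  convert hk using 1
  refine mul_left_cancel₀ (prime_form ht).ne_zero ?_
  rw [← h]
  ring

/-- By `add_polyAct_mem`, each reflection negates the class of `p` in `R`, so `W` acts on this class
by the sign character. -/
theorem smul_polyAct_sub_mem (hρ : Function.Injective ρ) {p : Poly V}
    (hp : ∀ t ∈ D.refl, ι ℝ _ (D.form t) * p ∈ coinvariantIdeal ρ) (w : W) :
    D.sign w • polyAct ρ w p - p ∈ coinvariantIdeal ρ := by
  have hmul (t : W) (ht : t ∈ D.refl) (y : W)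
      (hy : D.sign y • polyAct ρ y p - p ∈ coinvariantIdeal ρ) :
      D.sign (t * y) • polyAct ρ (t * y) p - p ∈ coinvariantIdeal ρ := by
    have h := neg_mem (add_mem (polyAct_mem_coinvariantIdeal ρ t hy) (add_polyAct_mem ht (hp t ht)))
    rw [map_sub, map_smul, ← polyAct_mul_apply] at h
    rw [map_mul, D.sign_eq t ht]
    convert h using 1
    module
  have hw : w ∈ Subgroup.closure D.refl := D.closure_eq ▸ Subgroup.mem_top w
  induction hw using Subgroup.closure_induction_left with
  | one => rw [polyAct_one_apply, map_one, one_smul, sub_self]; exact zero_mem _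
  | mul_left t ht y _ hy => exact hmul t ht y hy
  | inv_mul_cancel t ht y _ hy =>
    have : t⁻¹ = t := hρ (ρ_inv ht)
    rw [this]
    exact hmul t ht y hy

theorem polyAct_eq_of_refl {p : Poly V} {T : Set W} (hp : ∀ t ∈ T, polyAct ρ t p = p) {w : W}
    (hw : w ∈ Subgroup.closure T) : polyAct ρ w p = p := by
  induction hw using Subgroup.closure_induction with
  | mem t ht => exact hp t ht
  | one => exact polyAct_one_apply ρ p
  | mul x y _ _ hx hy => rw [polyAct_mul_apply, hy, hx]
  | inv x _ hx =>
    conv_lhs => rw [← hx]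
    rw [← polyAct_mul_apply, inv_mul_cancel, polyAct_one_apply]

variable [Finite W]

/-- Modulo `J`, `p` is the average of its signed translates, which is `Δ` times an invariant; and an
invariant is congruent to its constant term. -/
theorem exists_sub_smul_formProd_mem (hρ : Function.Injective ρ) {p : Poly V}
    (hp : ∀ t ∈ D.refl, ι ℝ _ (D.form t) * p ∈ coinvariantIdeal ρ) :
    ∃ c : ℝ, p - c • D.formProd (D.reflFinset ⊤) ∈ coinvariantIdeal ρ := by
  let _ := Fintype.ofFinite (⊤ : Subgroup W)
  set n : ℝ := (Fintype.card (⊤ : Subgroup W) : ℝ)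
  have hn : n ≠ 0 := by simp [n]
  have hsum : D.antisymmetrize ⊤ p - n • p ∈ coinvariantIdeal ρ := by
    have : n • p = ∑ _w : (⊤ : Subgroup W), p := by
      rw [Finset.sum_const, Finset.card_univ, Nat.cast_smul_eq_nsmul]
    rw [this, antisymmetrize, ← Finset.sum_sub_distrib]
    exact sum_mem fun w _ => smul_polyAct_sub_mem hρ hp w
  obtain ⟨q, hq⟩ := exists_antisymmetrize_eq_mul (D := D) hρ ⊤ p
  have hqt (t : W) (ht : t ∈ D.refl) : polyAct ρ t q = q := by
    have htr : t ∈ D.reflFinset ⊤ := by simpa using ht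
    have h := polyAct_antisymmetrize (D := D) p htr
    rw [hq, map_mul, polyAct_formProd hρ ⊤ htr, neg_mul, neg_inj] at h
    exact mul_left_cancel₀ (formProd_ne_zero (coe_reflFinset_subset ⊤)) h
  have hqJ := sub_algebraMap_mem_coinvariantIdeal ρ
    fun w => polyAct_eq_of_refl hqt (D.closure_eq ▸ Subgroup.mem_top w)
  refine ⟨n⁻¹ * algebraMapInv q, ?_⟩
  have h := add_mem (neg_mem hsum) (Ideal.mul_mem_left _ (D.formProd (D.reflFinset ⊤)) hqJ)
  have h' := Ideal.mul_mem_left _ (algebraMap ℝ _ n⁻¹) h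
  convert h' using 1
  rw [hq, ← Algebra.smul_def, mul_sub, mul_comm _ (algebraMap ℝ _ (algebraMapInv q)),
    ← Algebra.smul_def]
  match_scalars <;> field_simp
  ring

variable [FiniteDimensional ℝ V]

/-- Every nonzero element of the coinvariant ring divides a nonzero scalar multiple of the product
of the linear forms of all reflections. -/
theorem exists_mul_sub_smul_formProd_mem (hρ : Function.Injective ρ) {p : Poly V}
    (hp : p ∉ coinvariantIdeal ρ) :
    ∃ (g : Poly V) (c : ℝ), p * g ∉ coinvariantIdeal ρ ∧
      p * g - c • D.formProd (D.reflFinset ⊤) ∈ coinvariantIdeal ρ := by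
  obtain ⟨n, hn⟩ := exists_augmentationIdeal_pow_le ρ
  -- Multiply `p` by reflection forms as long as one keeps it outside `J`; nilpotency bounds the
  -- number of factors by `k`.
  have key (k : ℕ) : ∀ p : Poly V, p ∉ coinvariantIdeal ρ →
      (∀ a ∈ augmentationIdeal V ^ k, a * p ∈ coinvariantIdeal ρ) →
      ∃ (g : Poly V) (c : ℝ), p * g ∉ coinvariantIdeal ρ ∧
        p * g - c • D.formProd (D.reflFinset ⊤) ∈ coinvariantIdeal ρ := by
    induction k with
    | zero =>
      intro p hp h
      exact absurd (by simpa using h 1 (by simp)) hp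
    | succ k ih =>
      intro p hp h
      by_cases hall : ∀ t ∈ D.refl, ι ℝ _ (D.form t) * p ∈ coinvariantIdeal ρ
      · obtain ⟨c, hc⟩ := exists_sub_smul_formProd_mem hρ hall
        exact ⟨1, c, by rwa [mul_one], by rwa [mul_one]⟩
      · push Not at hall
        obtain ⟨t, _, htp⟩ := hall
        obtain ⟨g, c, hg, hgc⟩ := ih _ htp fun a ha => by
          rw [← mul_assoc]
          refine h _ ?_
          rw [pow_succ]
          exact Ideal.mul_mem_mul ha (ι_mem_augmentationIdeal _)
        rw [mul_comm (ι ℝ _ (D.form t)), mul_assoc] at hg hgc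
        exact ⟨_, c, hg, hgc⟩
  exact key n p hp fun a ha => Ideal.mul_mem_right _ _ (hn ha)

/-- Already `1 ∉ J` has a multiple outside `J` that is congruent to a scalar times `Δ`. -/
theorem formProd_top_notMem (hρ : Function.Injective ρ) :
    D.formProd (D.reflFinset ⊤) ∉ coinvariantIdeal ρ := fun h => by
  obtain ⟨g, c, hg, hgc⟩ := exists_mul_sub_smul_formProd_mem (D := D) hρ
    (one_notMem_coinvariantIdeal ρ)
  rw [Algebra.smul_def] at hgc
  exact hg ((Submodule.sub_mem_iff_left _ (Ideal.mul_mem_left _ _ h)).1 hgc)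

omit [Finite W] [FiniteDimensional ℝ V] in
theorem formProd_mem_polyComponent (A : Finset W) :
    D.formProd A ∈ polyComponent V A.card := by
  classical
  induction A using Finset.induction_on with
  | empty => simp [formProd, polyComponent]
  | insert t A ht ih =>
    rw [formProd, Finset.prod_insert ht, Finset.card_insert_of_notMem ht, mul_comm, polyComponent,
      pow_succ]
    exact Submodule.mul_mem_mul ih ⟨_, rfl⟩

omit [Finite W] [FiniteDimensional ℝ V] in
theorem coeff_homogenize_formProd (A : Finset W) :
    (homogenize V (D.formProd A)).coeff A.card = D.formProd A := by
  have : homogenize V (D.formProd A) = Polynomial.C (D.formProd A) * Polynomial.X ^ A.card := by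
    simp only [formProd, map_prod, homogenize_ι, Finset.prod_mul_distrib, Finset.prod_const]
    rw [mul_comm]
  rw [this, Polynomial.coeff_C_mul_X_pow, if_pos rfl]

/-- Compare the parts of degree `N`: that of `a` vanishes, and `J` is homogeneous and omits `Δ`. -/
theorem eq_zero_of_sub_smul_formProd_mem (hρ : Function.Injective ρ) {a : Poly V} {c : ℝ}
    (ha : a ∈ augmentationIdeal V ^ ((D.reflFinset ⊤).card + 1))
    (h : a - c • D.formProd (D.reflFinset ⊤) ∈ coinvariantIdeal ρ) : c = 0 := by
  have h1 := coeff_homogenize_mem_coinvariantIdeal ρ h (D.reflFinset ⊤).card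
  rw [map_sub, map_smul, Polynomial.coeff_sub, Polynomial.coeff_smul, coeff_homogenize_formProd,
    coeff_homogenize_eq_zero (Nat.lt_succ_self _) ha, zero_sub, neg_mem_iff] at h1
  by_contra hc
  have h2 := Ideal.mul_mem_left _ (algebraMap ℝ _ c⁻¹) h1
  rw [← Algebra.smul_def, smul_smul, inv_mul_cancel₀ hc, one_smul] at h2
  exact formProd_top_notMem hρ h2

/-- The invariants of `H` in the coinvariant ring vanish in degrees larger than the number of
reflections outside `H`. -/
theorem eq_zero_of_mem_component (hρ : Function.Injective ρ) (H : Subgroup W) {m : ℕ}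
    (hm : (D.reflFinset ⊤).card < m + (D.reflFinset H).card) {f : CoinvariantRing ρ}
    (hf : f ∈ component ρ m) (hH : ∀ w ∈ H, act ρ w f = f) : f = 0 := by
  let _ := Fintype.ofFinite H
  obtain ⟨p, hpm, rfl⟩ := hf
  by_contra hp0
  have hpJ : p ∉ coinvariantIdeal ρ := fun h => hp0 (Ideal.Quotient.eq_zero_iff_mem.2 h)
  obtain ⟨g, c, hg, hgc⟩ := exists_mul_sub_smul_formProd_mem (D := D) hρ hpJ
  -- Apply `w` to `p g ≡ c Δ`: it fixes `p` modulo `J` and multiplies `Δ` by its sign.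
  have hterm (w : H) : p * (D.sign w • polyAct ρ w g) - c • D.formProd (D.reflFinset ⊤) ∈
      coinvariantIdeal ρ := by
    have h1 : polyAct ρ w p - p ∈ coinvariantIdeal ρ := Ideal.Quotient.eq.1 (hH w w.2)
    have h2 := polyAct_mem_coinvariantIdeal ρ (w : W) hgc
    rw [map_sub, map_mul, map_smul, polyAct_formProd_top hρ] at h2
    have h3 := Ideal.mul_mem_left _ (algebraMap ℝ _ (D.sign w))
      (sub_mem h2 (Ideal.mul_mem_right (polyAct ρ w g) _ h1))
    convert h3 using 1
    rw [← Algebra.smul_def, mul_smul_comm]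
    simp only [smul_sub, sub_mul]
    rw [smul_comm (D.sign w) c, smul_smul (D.sign w), sign_mul_self, one_smul]
    abel
  have hsum : p * D.antisymmetrize H g - (Fintype.card H * c) • D.formProd (D.reflFinset ⊤) ∈
      coinvariantIdeal ρ := by
    have h := sum_mem fun w (_ : w ∈ (Finset.univ : Finset H)) => hterm w
    rw [Finset.sum_sub_distrib, ← Finset.mul_sum, Finset.sum_const, Finset.card_univ,
      ← Nat.cast_smul_eq_nsmul ℝ, smul_smul] at h
    exact h
  obtain ⟨q, hq⟩ := exists_antisymmetrize_eq_mul (D := D) hρ H g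
  have hmem : p * D.antisymmetrize H g ∈ augmentationIdeal V ^ ((D.reflFinset ⊤).card + 1) := by
    refine Ideal.pow_le_pow_right hm ?_
    rw [hq, ← mul_assoc, pow_add]
    exact Ideal.mul_mem_right _ _ (Ideal.mul_mem_mul (mem_augmentationIdeal_pow hpm)
      (mem_augmentationIdeal_pow (formProd_mem_polyComponent _)))
  have hc := eq_zero_of_sub_smul_formProd_mem hρ hmem hsum
  have hc0 : c = 0 := (mul_eq_zero.1 hc).resolve_left (by simp)
  rw [hc0, zero_smul, sub_zero] at hgc
  exact hg hgc

/-- The witness is `Δ / Δ_H` for the subgroup `H` generated by `T`: each `t ∈ T` negates both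
products, hence fixes the quotient, which is nonzero in `R` because it divides `Δ`. -/
theorem exists_ne_zero_mem_component (hρ : Function.Injective ρ) {T : Set W} (hT : T ⊆ D.refl) :
    ∃ f : CoinvariantRing ρ, f ≠ 0 ∧ (∀ w ∈ Subgroup.closure T, act ρ w f = f) ∧
      f ∈ component ρ
        ((D.reflFinset ⊤).card - (D.reflFinset (Subgroup.closure T)).card) := by
  classical
  have hsub : D.reflFinset (Subgroup.closure T) ⊆ D.reflFinset ⊤ := fun t ht => by
    simpa using (mem_reflFinset.1 ht).1
  set A := D.reflFinset ⊤ \ D.reflFinset (Subgroup.closure T)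
  have hmul : D.formProd A * D.formProd (D.reflFinset (Subgroup.closure T)) =
      D.formProd (D.reflFinset ⊤) := Finset.prod_sdiff hsub
  refine ⟨Ideal.Quotient.mk _ (D.formProd A), fun h => ?_, fun w hw => ?_, ?_⟩
  · refine formProd_top_notMem (D := D) hρ ?_
    rw [← hmul]
    exact Ideal.mul_mem_right _ _ (Ideal.Quotient.eq_zero_iff_mem.1 h)
  · rw [act_mk, polyAct_eq_of_refl (fun t ht => ?_) hw]
    have h := polyAct_formProd (D := D) hρ ⊤ (s := t) (by simpa using hT ht)
    rw [← hmul, map_mul, polyAct_formProd hρ (Subgroup.closure T)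
      (mem_reflFinset.2 ⟨hT ht, Subgroup.subset_closure ht⟩), mul_neg, neg_inj] at h
    exact mul_right_cancel₀ (formProd_ne_zero (coe_reflFinset_subset _)) h
  · rw [← Finset.card_sdiff_of_subset hsub]
    exact ⟨_, formProd_mem_polyComponent A, rfl⟩

end ReflectionSystem

/-! ### Lefschetz powers, Coxeter reflections, and the conclusion. -/

theorem pow_mem_component {W V : Type*} [Group W] [AddCommGroup V] [Module ℝ V]
    (ρ : Representation ℝ W V) {f : CoinvariantRing ρ} (hf : f ∈ component ρ 1) (m : ℕ) :
    f ^ m ∈ component ρ m := by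
  obtain ⟨p, hp, rfl⟩ := hf
  refine ⟨p ^ m, ?_, map_pow (Ideal.Quotient.mk _) _ _⟩
  rw [SetLike.mem_coe, polyComponent, pow_one] at hp
  exact Submodule.pow_mem_pow _ hp m

theorem IsStrongLefschetzElement.exists_pow_ne_zero {A : Type*} [CommRing A] [Algebra ℝ A]
    [Nontrivial A] {𝒜 : ℕ → Submodule ℝ A} {ℓ : A} (h : IsStrongLefschetzElement 𝒜 ℓ)
    (h1 : (1 : A) ∈ 𝒜 0) : ∃ m : ℕ, (∀ d, m < d → 𝒜 d = ⊥) ∧ ℓ ^ m ≠ 0 := by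
  obtain ⟨_, m, hm, _, hbij⟩ := h
  refine ⟨m, hm, fun h0 => one_ne_zero ((hbij 0 (Nat.zero_le _)).injOn h1 (zero_mem _) ?_)⟩
  simp [h0]

theorem isLinearReflection_conj {W V : Type*} [Group W] [AddCommGroup V] [Module ℝ V]
    (ρ : Representation ℝ W V) {t : W} (ht : IsLinearReflection (ρ t)) (w : W) :
    IsLinearReflection (ρ (w * t * w⁻¹)) := by
  obtain ⟨x, f, hx, h⟩ := ht
  have hinv (y : V) : ρ w⁻¹ (ρ w y) = y := by
    rw [← Module.End.mul_apply, ← map_mul, inv_mul_cancel, map_one, Module.End.one_apply]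
  have hinv' (y : V) : ρ w (ρ w⁻¹ y) = y := by
    rw [← Module.End.mul_apply, ← map_mul, mul_inv_cancel, map_one, Module.End.one_apply]
  refine ⟨ρ w x, f ∘ₗ ρ w⁻¹, by rw [LinearMap.comp_apply, hinv, hx], ?_⟩
  ext y
  rw [map_mul, map_mul, h]
  simp only [Module.End.mul_apply, Module.preReflection_apply, map_sub, map_smul, hinv',
    LinearMap.comp_apply]

theorem exists_reflectionSystem {B W V : Type*} [Group W] {M : CoxeterMatrix B}
    (cs : CoxeterSystem M W) [AddCommGroup V] [Module ℝ V] (ρ : Representation ℝ W V)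
    (hrefl : ∀ i : B, IsLinearReflection (ρ (cs.simple i))) :
    ∃ D : ReflectionSystem ρ, D.refl = {t | cs.IsReflection t} := by
  have h (t : W) (ht : cs.IsReflection t) : IsLinearReflection (ρ t) := by
    obtain ⟨w, i, rfl⟩ := ht
    exact isLinearReflection_conj ρ (hrefl i) w
  choose! x f hx hf using h
  -- The Coxeter relations hold because `(-1) * (-1) = 1`.
  let ε : W →* ℝ := cs.lift ⟨fun _ => -1, fun i j => by simp⟩
  have hε (i : B) : ε (cs.simple i) = -1 := cs.lift_apply_simple _ i
  refine ⟨⟨{t | cs.IsReflection t}, x, f, ε, fun w t ht => ht.conj w, ?_, hx, hf, ?_⟩, rfl⟩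
  · rw [eq_top_iff, ← cs.subgroup_closure_range_simple]
    refine Subgroup.closure_mono ?_
    rintro _ ⟨i, rfl⟩
    exact cs.isReflection_simple i
  · rintro _ ⟨w, i, rfl⟩
    rw [map_mul, map_mul, hε, mul_right_comm, ← map_mul, mul_inv_cancel, map_one, one_mul]

end Coinvariant

end

theorem mainTheorem5 {B W V : Type*} [Group W] [Finite W] {M : CoxeterMatrix B}
    (cs : CoxeterSystem M W) [AddCommGroup V] [Module ℝ V] [FiniteDimensional ℝ V]
    (ρ : Representation ℝ W V) (hρ : Function.Injective ρ)
    (hrefl : ∀ i : B, Coinvariant.IsLinearReflection (ρ (cs.simple i)))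
    (S : Set B)
    (ℓ : Coinvariant.invariants ρ (Coinvariant.parabolicSubgroup cs S))
    (hℓ : Coinvariant.IsStrongLefschetzElement
      (Coinvariant.invariantsComponent ρ (Coinvariant.parabolicSubgroup cs S)) ℓ)
    (t : W) (ht : cs.IsReflection t) (htS : t ∉ Coinvariant.parabolicSubgroup cs S) :
    Coinvariant.act ρ t (ℓ : Coinvariant.CoinvariantRing ρ) ≠ ℓ := by
  intro hfix
  obtain ⟨D, hD⟩ := Coinvariant.exists_reflectionSystem cs ρ hrefl
  have hS : cs.simple '' S ⊆ D.refl := by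
    rw [hD]
    rintro _ ⟨i, -, rfl⟩
    exact cs.isReflection_simple i
  have : Nontrivial (Coinvariant.CoinvariantRing ρ) := Ideal.Quotient.nontrivial_iff.2
    ((Ideal.ne_top_iff_one _).2 (Coinvariant.one_notMem_coinvariantIdeal ρ))
  obtain ⟨m, hm, hpow⟩ := hℓ.exists_pow_ne_zero
    ⟨1, by simp [Coinvariant.polyComponent], map_one (Ideal.Quotient.mk _)⟩
  obtain ⟨f, hf0, hfP, hfd⟩ := Coinvariant.ReflectionSystem.exists_ne_zero_mem_component hρ hS
  rw [← Coinvariant.parabolicSubgroup] at hfP hfd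
  generalize Coinvariant.parabolicSubgroup cs S = P at *
  have hdm : (D.reflFinset ⊤).card - (D.reflFinset P).card ≤ m := by
    by_contra! hlt
    have hmem : (⟨f, hfP⟩ : Coinvariant.invariants ρ P) ∈
        Coinvariant.invariantsComponent ρ P _ := hfd
    rw [hm _ hlt, Submodule.mem_bot] at hmem
    exact hf0 (congrArg Subtype.val hmem)
  -- `H` need not be parabolic or generated by reflections; the vanishing bound holds for any
  -- subgroup.
  let H := Coinvariant.stabilizer ρ (ℓ : Coinvariant.CoinvariantRing ρ)
  have hPH : D.reflFinset P ⊂ D.reflFinset H := by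
    rw [Finset.ssubset_iff_of_subset fun s hs => ?_]
    · have htr : t ∈ D.refl := hD ▸ ht
      exact ⟨t, Coinvariant.ReflectionSystem.mem_reflFinset.2 ⟨htr, hfix⟩, fun h =>
        htS (Coinvariant.ReflectionSystem.mem_reflFinset.1 h).2⟩
    · rw [Coinvariant.ReflectionSystem.mem_reflFinset] at hs ⊢
      exact ⟨hs.1, ℓ.2 s hs.2⟩
  have hcard := Finset.card_lt_card hPH
  refine hpow (Subtype.ext ?_)
  refine Coinvariant.ReflectionSystem.eq_zero_of_mem_component (D := D) hρ H (by omega)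
    (Coinvariant.pow_mem_component ρ hℓ.1 m) fun w hw => ?_
  rw [SubmonoidClass.coe_pow, map_pow, (Coinvariant.mem_stabilizer ρ).1 hw]
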